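/- Let $X$ be a compact metrizable abelian group, let $\mathbf{u}=(u_n)_{n\in\mathbb N}$ be a sequence of continuous characters $u_n:X\to\mathbb T$, where $\mathbb T$ is the unit circle in $\mathbb C$, and let $$s_{\mathbf u}(X)=\{x\in X:\ u_n(x)\to 1\}$$ be the subgroup of $X$ characterized by $\mathbf u$. Let $\mathbb T_0^H$ be the group of all sequences $(z_n)$ in $\mathbb T$ with $z_n\to 1$, with the topology of the metric $d_0((z_n),(w_n))=\sup_n|z_n-w_n|$, and let $$G_{\mathbf u}=\{(g,(u_n(g))_n):\ g\in s_{\mathbf u}(X)\}\subseteq X\times\mathbb T_0^H .$$ Then $G_{\mathbf u}$ is a closed subgroup of $X\times\mathbb T_0^H$, and there is a topology $\tau$ on $s_{\mathbf u}(X)$ such that $(s_{\mathbf u}(X),\tau)$ is a locally quasi-convex Polish topological group, the inclusion $(s_{\mathbf u}(X),\tau)\to X$ is continuous, and $g\mapsto (g,(u_n(g))_n)$ is an isomorphism of topological groups from $(s_{\mathbf u}(X),\tau)$ onto $G_{\mathbf u}$ with the topology induced from $X\times\mathbb T_0^H$. Here a subset $A$ of an abelian topological group $G$ is quasi-convex if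 for every $g\in G\setminus A$ there is a continuous character $\chi:G\to\mathbb T$ with $\operatorname{Re}\chi(a)\ge 0$ for all $a\in A$ and $\operatorname{Re}\chi(g)<0$; and $G$ is locally quasi-convex if the quasi-convex neighborhoods of the identity form a neighborhood basis of the identity. -/

import Mathlib

open Filter Topology

noncomputable section

/-- The subgroup `s_u(X) = {x ∈ X : u n x → 1}` characterized by a sequence `u` of continuous
characters of `X`. -/
def characterizedSubgroup {X : Type*} [CommGroup X] [TopologicalSpace X]
    (u : ℕ → PontryaginDual X) : Subgroup X where
  carrier := {x | Tendsto (fun n => u n x) atTop (𝓝 1)}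
  one_mem' := by simp
  mul_mem' {a b} ha hb := by
    have h := Filter.Tendsto.mul ha hb
    simpa using h
  inv_mem' {a} ha := by
    have h := Filter.Tendsto.inv ha
    simpa using h

/-- Sequences in the circle group converging to `1`, as a subgroup of `𝕋^ℕ`. -/
def circleNullSubgroup : Subgroup (ℕ → Circle) where
  carrier := {z | Tendsto z atTop (𝓝 1)}
  one_mem' := tendsto_const_nhds
  mul_mem' {a b} ha hb := by
    have h := Filter.Tendsto.mul ha hb
    rwa [mul_one] at h
  inv_mem' {a} ha := by
    have h := Filter.Tendsto.inv ha
    rwa [inv_one] at h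

/-- The group `𝕋₀ᴴ` of sequences in the circle group converging to `1`. This is a type synonym of
`circleNullSubgroup`, so that it does not inherit the product topology: its topology is the one
of the uniform metric below. -/
def T0H : Type := circleNullSubgroup

namespace T0H

instance instCommGroup : CommGroup T0H := inferInstanceAs (CommGroup circleNullSubgroup)

/-- The `n`-th coordinate of an element of `𝕋₀ᴴ`. -/
def coord (z : T0H) (n : ℕ) : Circle := z.1 n

theorem ext_coord {z w : T0H} (h : ∀ n, z.coord n = w.coord n) : z = w :=
  Subtype.ext (funext h)

theorem bddAbove_dist (z w : T0H) :
    BddAbove (Set.range fun n => ‖(z.coord n : ℂ) - (w.coord n : ℂ)‖) := by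
  refine ⟨2, ?_⟩
  rintro _ ⟨n, rfl⟩
  refine (norm_sub_le _ _).trans ?_
  rw [Circle.norm_coe, Circle.norm_coe]
  norm_num

/-- The metric `d₀(z, w) = sup_n |z_n - w_n|`. -/
instance instMetricSpace : MetricSpace T0H where
  dist z w := ⨆ n, ‖(z.coord n : ℂ) - (w.coord n : ℂ)‖
  dist_self z := by simp
  dist_comm z w := by simp only [norm_sub_rev]
  dist_triangle x y z := by
    refine ciSup_le fun n => ?_
    have h1 := le_ciSup (bddAbove_dist x y) n
    have h2 := le_ciSup (bddAbove_dist y z) n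
    exact (norm_sub_le_norm_sub_add_norm_sub _ _ _).trans (add_le_add h1 h2)
  eq_of_dist_eq_zero {z w} h := by
    refine ext_coord fun n => ?_
    have h1 := le_ciSup (bddAbove_dist z w) n
    have h2 : ‖(z.coord n : ℂ) - (w.coord n : ℂ)‖ ≤ 0 := h1.trans_eq h
    exact Circle.ext (sub_eq_zero.mp (norm_le_zero_iff.mp h2))

end T0H

/-- The subgroup `G_u = {(g, (u n g)_n) : g ∈ s_u(X)}` of `X × 𝕋₀ᴴ`. -/
def graphSubgroup {X : Type*} [CommGroup X] [TopologicalSpace X]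
    (u : ℕ → PontryaginDual X) : Subgroup (X × T0H) where
  carrier := {p | p.1 ∈ characterizedSubgroup u ∧ ∀ n, p.2.coord n = u n p.1}
  one_mem' := ⟨one_mem _, fun n => (map_one (u n)).symm⟩
  mul_mem' {p q} hp hq := ⟨mul_mem hp.1 hq.1, fun n => by
    rw [Prod.fst_mul, map_mul, ← hp.2 n, ← hq.2 n]; rfl⟩
  inv_mem' {p} hp := ⟨inv_mem hp.1, fun n => by
    rw [Prod.fst_inv, map_inv, ← hp.2 n]; rfl⟩

/-- A subset `A` of an abelian topological group is quasi-convex if every `g ∉ A` is separated from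
`A` by a continuous character that maps `A` into the right half `{z : 0 ≤ Re z}` of the circle and
maps `g` outside of it. -/
def IsQuasiConvex {G : Type*} [CommGroup G] [TopologicalSpace G] (A : Set G) : Prop :=
  ∀ g ∉ A, ∃ χ : PontryaginDual G, (∀ a ∈ A, 0 ≤ (χ a : ℂ).re) ∧ (χ g : ℂ).re < 0

/-- An abelian topological group is locally quasi-convex if the quasi-convex neighborhoods of the
identity form a neighborhood basis at the identity. -/
def IsLocallyQuasiConvex (G : Type*) [CommGroup G] [TopologicalSpace G] : Prop :=
  ∀ U ∈ 𝓝 (1 : G), ∃ V ∈ 𝓝 (1 : G), V ⊆ U ∧ IsQuasiConvex V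

end

/-! ### Enough continuous characters on compact abelian groups -/

open MeasureTheory

/-! In `X × T0H` the graph is cut out by the closed conditions `z_n = u_n(x)`, convergence being
built into `T0H`. As both factors are Polish and locally quasi-convex, so is the graph, and its
topology is pulled back to `s_u(X)`. For `T0H`, if `z, z², z⁴, …` stay long enough in the right half
circle then `z` is near 1, with a length independent of the coordinate; hence finitely many powers
of each coordinate character control the sup metric. For `X`, continuous characters must separate
points. The regular representation on `L²` is faithful and generates a commutative C⋆-algebra; a
Gelfand character of it that detects a suitable operator restricts to a continuous character of the
group. Compactness then embeds `X` in a power of the circle. -/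

/-- The double centralizer of a commuting star-closed set in a C⋆-algebra has enough characters to
detect its nonzero elements. -/
theorem exists_starAlgHom_apply_ne_zero {A : Type*} [CStarAlgebra A] (S : Set A)
    (hcomm : ∀ a ∈ S, ∀ b ∈ S, a * b = b * a) (hstar : ∀ a ∈ S, star a ∈ S)
    (c : StarSubalgebra.centralizer ℂ (StarSubalgebra.centralizer ℂ S : Set A)) (hc : c ≠ 0) :
    ∃ φ : StarSubalgebra.centralizer ℂ (StarSubalgebra.centralizer ℂ S : Set A) →⋆ₐ[ℂ] ℂ,
      φ c ≠ 0 := by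
  -- `S ⊆ S'` gives `S'' ⊆ S'`, so `S''` is commutative and the Gelfand transform is injective on
  -- it.
  have hSN : S ⊆ (StarSubalgebra.centralizer ℂ S : Set A) := fun a ha =>
    StarSubalgebra.mem_centralizer_iff ℂ |>.2 fun b hb =>
      ⟨hcomm _ hb _ ha, hcomm _ (hstar _ hb) _ ha⟩
  let M := StarSubalgebra.centralizer ℂ (StarSubalgebra.centralizer ℂ S : Set A)
  have hMN : M ≤ StarSubalgebra.centralizer ℂ S := StarSubalgebra.centralizer_le ℂ _ _ hSN
  have hclosed : IsClosed (M : Set A) := by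
    rw [StarSubalgebra.coe_centralizer]
    exact Set.isClosed_centralizer _
  let _ : CStarAlgebra M := StarSubalgebra.cstarAlgebra M
  let _ : CommCStarAlgebra M :=
    { (inferInstance : CStarAlgebra M) with
      mul_comm := fun a b => Subtype.ext
        ((StarSubalgebra.mem_centralizer_iff ℂ).1 b.2 a (hMN a.2)).1 }
  have hne : gelfandStarTransform M c ≠ 0 := by
    rw [Ne, EmbeddingLike.map_eq_zero_iff]
    exact hc
  obtain ⟨ψ, hψ⟩ : ∃ ψ, gelfandStarTransform M c ψ ≠ 0 := by
    by_contra! h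
    exact hne (ContinuousMap.ext h)
  exact ⟨⟨WeakDual.CharacterSpace.toAlgHom ψ, fun a => map_star ψ a⟩, hψ⟩

section Representation

variable {G : Type*} [CommGroup G] [TopologicalSpace G] [IsTopologicalGroup G] [CompactSpace G]
  [SecondCountableTopology G] [MeasurableSpace G] [BorelSpace G]
  {H : Type*} [NormedAddCommGroup H] [InnerProductSpace ℂ H] [CompleteSpace H]

theorem integrable_smul_orbit (μ : Measure G) [IsFiniteMeasure μ]
    (π : G →* unitary (H →L[ℂ] H)) (hπ : ∀ v, Continuous fun x => (π x : H →L[ℂ] H) v)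
    (f : C(G, ℂ)) (v : H) : Integrable (fun x => f x • (π x : H →L[ℂ] H) v) μ :=
  (f.continuous.smul (hπ v)).integrable_of_hasCompactSupport
    (HasCompactSupport.of_compactSpace _)

/-- The operators `∫ f x • π x ∂μ`, for continuous functions `f`, of a strongly continuous unitary
representation `π` of a compact group. -/
noncomputable def integratedRep (μ : Measure G) [IsFiniteMeasure μ]
    (π : G →* unitary (H →L[ℂ] H)) (hπ : ∀ v, Continuous fun x => (π x : H →L[ℂ] H) v) :
    C(G, ℂ) →L[ℂ] H →L[ℂ] H :=
  LinearMap.mkContinuous₂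
    (LinearMap.mk₂ ℂ (fun (f : C(G, ℂ)) (v : H) => ∫ x, f x • (π x : H →L[ℂ] H) v ∂μ)
      (fun f g v => by
        simp only [ContinuousMap.add_apply, add_smul]
        exact integral_add (integrable_smul_orbit μ π hπ f v) (integrable_smul_orbit μ π hπ g v))
      (fun c f v => by
        simp only [ContinuousMap.smul_apply, smul_assoc]
        exact integral_smul c _)
      (fun f v w => by
        simp only [map_add, smul_add]
        exact integral_add (integrable_smul_orbit μ π hπ f v) (integrable_smul_orbit μ π hπ f w))
      (fun c f v => by
        simp only [map_smul, smul_comm _ c]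
        exact integral_smul c _))
    (μ.real Set.univ) fun f v => by
      have h := norm_integral_le_of_norm_le_const (μ := μ) (C := ‖f‖ * ‖v‖)
        (f := fun x => f x • (π x : H →L[ℂ] H) v) (Eventually.of_forall fun x => by
          rw [norm_smul, Unitary.norm_map]
          gcongr
          exact f.norm_coe_le_norm x)
      refine h.trans_eq ?_
      ring

/-- A character of a C⋆-subalgebra that contains the operators of a unitary representation restricts
to a group homomorphism into the circle. -/
noncomputable def circleHomOfStarAlgHom (M : StarSubalgebra ℂ (H →L[ℂ] H)) (φ : M →⋆ₐ[ℂ] ℂ)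
    (π : G →* unitary (H →L[ℂ] H)) (hM : ∀ x, (π x : H →L[ℂ] H) ∈ M) : G →* Circle where
  toFun x := ⟨φ ⟨π x, hM x⟩, by
    have h : star (⟨π x, hM x⟩ : M) * ⟨π x, hM x⟩ = 1 :=
      Subtype.ext (Unitary.coe_star_mul_self (π x))
    have h2 : star (φ ⟨π x, hM x⟩) * φ ⟨π x, hM x⟩ = 1 := by
      rw [← map_star, ← map_mul, h, map_one]
    have h3 : ‖φ ⟨π x, hM x⟩‖ * ‖φ ⟨π x, hM x⟩‖ = 1 := by
      simpa only [norm_mul, norm_star, norm_one] using congrArg norm h2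
    exact mem_sphere_zero_iff_norm.2 (by nlinarith [norm_nonneg (φ ⟨π x, hM x⟩)])⟩
  map_one' := Circle.ext <| by
    change φ ⟨π 1, hM 1⟩ = 1
    rw [← map_one φ]
    exact congrArg φ (Subtype.ext (by simp))
  map_mul' x y := Circle.ext <| by
    change φ ⟨π (x * y), hM (x * y)⟩ = φ ⟨π x, hM x⟩ * φ ⟨π y, hM y⟩
    rw [← map_mul φ]
    exact congrArg φ (Subtype.ext (by simp))

/-- A compact abelian group with a strongly continuous unitary representation has a continuous
character that is nontrivial at any given element that the representation does not kill. -/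
theorem exists_pontryaginDual_apply_ne_one_of_unitaryRep (μ : Measure G) [IsFiniteMeasure μ]
    [μ.IsOpenPosMeasure] [μ.IsMulLeftInvariant]
    (π : G →* unitary (H →L[ℂ] H)) (hπ : ∀ v, Continuous fun x => (π x : H →L[ℂ] H) v)
    (a : G) (ha : π a ≠ 1) : ∃ χ : PontryaginDual G, χ a ≠ 1 := by
  set T := integratedRep μ π hπ
  set S : Set (H →L[ℂ] H) := Set.range fun x => (π x : H →L[ℂ] H)
  have hcomm : ∀ a ∈ S, ∀ b ∈ S, a * b = b * a := by
    rintro _ ⟨x, rfl⟩ _ ⟨y, rfl⟩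
    change ((π x * π y : unitary (H →L[ℂ] H)) : H →L[ℂ] H) = (π y * π x : unitary (H →L[ℂ] H))
    rw [← map_mul, mul_comm, map_mul]
  have hstar : ∀ a ∈ S, star a ∈ S := by
    rintro _ ⟨x, rfl⟩
    exact ⟨x⁻¹, congrArg Subtype.val (map_inv π x)⟩
  set M := StarSubalgebra.centralizer ℂ (StarSubalgebra.centralizer ℂ S : Set (H →L[ℂ] H)) with hMdef
  have hM : ∀ c : H →L[ℂ] H, (∀ b : H →L[ℂ] H, (∀ x, b * π x = π x * b) → b * c = c * b) →
      c ∈ M := by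
    intro c hc
    refine (StarSubalgebra.mem_centralizer_iff ℂ).2 fun b hb => ?_
    have h1 : ∀ b ∈ StarSubalgebra.centralizer ℂ S, b * c = c * b := fun b hb =>
      hc b fun x => ((StarSubalgebra.mem_centralizer_iff ℂ).1 hb _ ⟨x, rfl⟩).1.symm
    exact ⟨h1 b hb, h1 _ (star_mem hb)⟩
  have hπM : ∀ x, (π x : H →L[ℂ] H) ∈ M := fun x => hM _ fun b hb => hb x
  have hTM : ∀ f, T f ∈ M := by
    refine fun f => hM _ fun b hb => ContinuousLinearMap.ext fun v => ?_
    change b (∫ x, f x • (π x : H →L[ℂ] H) v ∂μ) = ∫ x, f x • (π x : H →L[ℂ] H) (b v) ∂μ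
    rw [← b.integral_comp_comm (integrable_smul_orbit μ π hπ f v)]
    congr 1
    ext1 x
    rw [map_smul]
    exact congrArg (f x • ·) (DFunLike.congr_fun (hb x) v)
  have hshift : ∀ y f, (π y : H →L[ℂ] H) * T f =
      T (f.comp (ContinuousMap.mk (fun x => y⁻¹ * x) (by fun_prop))) := by
    refine fun y f => ContinuousLinearMap.ext fun v => ?_
    change (π y : H →L[ℂ] H) (∫ x, f x • (π x : H →L[ℂ] H) v ∂μ) =
      ∫ x, f (y⁻¹ * x) • (π x : H →L[ℂ] H) v ∂μ
    rw [← (π y : H →L[ℂ] H).integral_comp_comm (integrable_smul_orbit μ π hπ f v),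
      ← integral_mul_left_eq_self (μ := μ) (fun x => f (y⁻¹ * x) • (π x : H →L[ℂ] H) v) y]
    congr 1
    ext1 x
    simp
  -- Multiplying by `T f` serves two ends: a Gelfand character nonzero on the product has `φ (π a) ≠
  -- 1`, and it has `φ (T f) ≠ 0`, which yields continuity below.
  obtain ⟨f, hf⟩ : ∃ f, ((π a : H →L[ℂ] H) - 1) * T f ≠ 0 := by
    by_contra! h
    refine ha (Subtype.ext (ContinuousLinearMap.ext fun v => ?_))
    have hcomm' : ∀ x, (π x : H →L[ℂ] H) ((π a : H →L[ℂ] H) v - v) =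
        ((π a : H →L[ℂ] H) - 1) ((π x : H →L[ℂ] H) v) := fun x => by
      have := DFunLike.congr_fun (hcomm _ ⟨x, rfl⟩ _ ⟨a, rfl⟩) v
      simp only [mul_apply_eq_comp] at this
      simp [this]
    set w := (π a : H →L[ℂ] H) v - v with hw
    -- With this matrix coefficient, pairing `∫ f x • π x w` with `w` gives `∫ ‖f‖²`; its vanishing
    -- forces `f 1 = ⟪w, w⟫ = 0`.
    let f : C(G, ℂ) := ⟨fun x => inner ℂ ((π x : H →L[ℂ] H) w) w, (hπ w).inner continuous_const⟩
    have h1 : ∫ x, f x • (π x : H →L[ℂ] H) w ∂μ = 0 := by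
      have h2 := DFunLike.congr_fun (h f) v
      change ((π a : H →L[ℂ] H) - 1) (∫ x, f x • (π x : H →L[ℂ] H) v ∂μ) = 0 at h2
      rw [← ContinuousLinearMap.integral_comp_comm _ (integrable_smul_orbit μ π hπ f v)] at h2
      rw [← h2]
      congr 1
      ext1 x
      rw [map_smul, hcomm']
    have h3 : ∫ x, ‖f x‖ ^ 2 ∂μ = 0 := by
      have h4 := congrArg (fun z => inner ℂ w z) h1
      simp only [inner_zero_right] at h4
      rw [← integral_inner (integrable_smul_orbit μ π hπ f w)] at h4
      have h5 : ∀ x, inner ℂ w (f x • (π x : H →L[ℂ] H) w) = ((‖f x‖ ^ 2 : ℝ) : ℂ) := fun x => by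
        rw [inner_smul_right, ← inner_conj_symm]
        change f x * star (f x) = _
        simpa using RCLike.mul_conj (f x)
      simp only [h5] at h4
      rw [integral_complex_ofReal] at h4
      exact_mod_cast h4
    have h6 : f 1 = 0 := by
      by_contra h7
      have h8 : 0 < ∫ x, ‖f x‖ ^ 2 ∂μ :=
        (f.continuous.norm.pow 2).integral_pos_of_hasCompactSupport_nonneg_nonzero
          (HasCompactSupport.of_compactSpace _) (fun x => by positivity) (x := 1)
          (by simpa using h7)
      exact h8.ne' h3
    have h9 : inner ℂ w w = 0 := by simpa [f] using h6
    rw [inner_self_eq_zero, hw, sub_eq_zero] at h9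
    simpa using h9
  obtain ⟨φ, hφ⟩ := exists_starAlgHom_apply_ne_zero S hcomm hstar
    ⟨((π a : H →L[ℂ] H) - 1) * T f, mul_mem (sub_mem (hπM a) (one_mem _)) (hTM f)⟩
    (fun h => hf (congrArg Subtype.val h))
  have hsplit : φ ⟨((π a : H →L[ℂ] H) - 1) * T f,
      mul_mem (sub_mem (hπM a) (one_mem _)) (hTM f)⟩ =
      (φ ⟨π a, hπM a⟩ - 1) * φ ⟨T f, hTM f⟩ := by
    rw [← map_one φ, ← map_sub, ← map_mul]
    rfl
  rw [hsplit] at hφ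
  have hφT := right_ne_zero_of_mul hφ
  -- `π` is only strongly continuous, but `π y * T f = T (f (y⁻¹ ·))` is norm continuous in `y`;
  -- dividing by `φ (T f)` recovers `φ (π y)`.
  have hcont : Continuous fun x => φ ⟨π x, hπM x⟩ := by
    have h1 : Continuous fun y : G =>
        f.comp (ContinuousMap.mk (fun x => y⁻¹ * x) (by fun_prop)) :=
      ContinuousMap.continuous_of_continuous_uncurry _ (by
        change Continuous fun p : G × G => f (p.1⁻¹ * p.2)
        fun_prop)
    have h2 : Continuous fun y : G => (π y : H →L[ℂ] H) * T f := by
      simp only [hshift]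
      exact T.continuous.comp h1
    have h3 : Continuous fun y => φ ⟨(π y : H →L[ℂ] H) * T f, mul_mem (hπM y) (hTM f)⟩ := by
      have : IsClosed (M : Set (H →L[ℂ] H)) := by
        rw [hMdef, StarSubalgebra.coe_centralizer]
        exact Set.isClosed_centralizer _
      let _ : CStarAlgebra M := StarSubalgebra.cstarAlgebra M
      have hφc : Continuous φ := map_continuous φ
      exact hφc.comp (h2.subtype_mk _)
    have h4 : (fun y => φ ⟨π y, hπM y⟩) = fun y =>
        φ ⟨(π y : H →L[ℂ] H) * T f, mul_mem (hπM y) (hTM f)⟩ / φ ⟨T f, hTM f⟩ := by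
      ext1 y
      rw [eq_div_iff hφT, ← map_mul]
      rfl
    rw [h4]
    exact h3.div_const _
  refine ⟨(⟨circleHomOfStarAlgHom M φ π hπM, hcont.subtype_mk _⟩ : G →ₜ* Circle), fun h => ?_⟩
  refine left_ne_zero_of_mul hφ ?_
  rw [sub_eq_zero]
  exact congrArg Subtype.val h

end Representation

/-! ### The regular representation separates points -/

section Translation

variable {G : Type*} [CommGroup G] [TopologicalSpace G] [IsTopologicalGroup G]
  [MeasurableSpace G] [BorelSpace G]

/-- Translation by an element of the group, as an isometry of `L²`. -/
noncomputable def translationLp (μ : Measure G) [μ.IsMulLeftInvariant] (x : G) :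
    Lp ℂ 2 μ ≃ₗᵢ[ℂ] Lp ℂ 2 μ where
  toFun f := DomMulAct.mk x • f
  invFun f := (DomMulAct.mk x)⁻¹ • f
  left_inv f := inv_smul_smul _ f
  right_inv f := smul_inv_smul _ f
  map_add' f g := smul_add _ f g
  map_smul' c f := smul_comm _ c f
  norm_map' f := DomMulAct.norm_smul_Lp _ f

/-- The regular representation of an abelian group on `L²`. -/
noncomputable def regularRep (μ : Measure G) [μ.IsMulLeftInvariant] :
    G →* unitary (Lp ℂ 2 μ →L[ℂ] Lp ℂ 2 μ) where
  toFun x := Unitary.linearIsometryEquiv.symm (translationLp μ x)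
  map_one' := by
    rw [← map_one Unitary.linearIsometryEquiv.symm]
    exact congrArg _ (LinearIsometryEquiv.ext fun f => one_smul Gᵈᵐᵃ f)
  map_mul' x y := by
    -- `DomMulAct` reverses products, so commutativity is needed here.
    rw [← map_mul Unitary.linearIsometryEquiv.symm, mul_comm x y]
    exact congrArg _ (LinearIsometryEquiv.ext fun f =>
      mul_smul (DomMulAct.mk x) (DomMulAct.mk y) f)

theorem regularRep_apply (μ : Measure G) [μ.IsMulLeftInvariant] (x : G) (f : Lp ℂ 2 μ) :
    (regularRep μ x : Lp ℂ 2 μ →L[ℂ] Lp ℂ 2 μ) f = DomMulAct.mk x • f := by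
  change (Unitary.linearIsometryEquiv.symm (translationLp μ x) : Lp ℂ 2 μ →L[ℂ] Lp ℂ 2 μ) f = _
  rw [Unitary.coe_symm_linearIsometryEquiv_apply]
  rfl

theorem exists_pontryaginDual_apply_ne_one {X : Type*} [CommGroup X] [TopologicalSpace X]
    [IsTopologicalGroup X] [CompactSpace X] [TopologicalSpace.MetrizableSpace X] {a : X}
    (ha : a ≠ 1) : ∃ χ : PontryaginDual X, χ a ≠ 1 := by
  let _ : MeasurableSpace X := borel X
  have : BorelSpace X := ⟨rfl⟩
  let _ := TopologicalSpace.metrizableSpaceMetric X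
  have : SecondCountableTopology X := inferInstance
  let μ : Measure X := Measure.haar
  have hcont : ∀ v : Lp ℂ 2 μ,
      Continuous fun x => (regularRep μ x : Lp ℂ 2 μ →L[ℂ] Lp ℂ 2 μ) v := fun v => by
    have : Fact ((2 : ENNReal) ≠ ⊤) := ⟨by simp⟩
    simp only [regularRep_apply]
    exact (DomMulAct.continuous_mk).smul continuous_const
  refine exists_pontryaginDual_apply_ne_one_of_unitaryRep μ (regularRep μ) hcont a fun h => ha ?_
  by_contra hne
  -- The distance to `1` vanishes only at `1`, so invariance under `a`, evaluated at `1`, would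
  -- force `a = 1`.
  let f : C(X, ℂ) := ⟨fun x => (dist x 1 : ℂ), by fun_prop⟩
  have hf : MemLp f 2 μ := f.continuous.memLp_of_hasCompactSupport
    (HasCompactSupport.of_compactSpace _)
  have h1 : DomMulAct.mk a • hf.toLp f = hf.toLp f := by
    rw [← regularRep_apply, h]
    rfl
  rw [DomMulAct.mk_smul_toLp, MemLp.toLp_eq_toLp_iff] at h1
  have h2 : (fun x => f (a • x)) = f :=
    Measure.eq_of_ae_eq h1 (f.continuous.comp (continuous_const_smul a)) f.continuous
  have h3 := congrFun h2 1
  simp [f] at h3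
  exact ha h3

end Translation

/-! ### Permanence of quasi-convexity; the circle and compact groups -/

section QuasiConvex

theorem IsQuasiConvex.preimage {G H : Type*} [CommGroup G] [TopologicalSpace G] [CommGroup H]
    [TopologicalSpace H] {A : Set H} (hA : IsQuasiConvex A) (f : G →ₜ* H) :
    IsQuasiConvex (f ⁻¹' A) := by
  intro g hg
  obtain ⟨χ, h1, h2⟩ := hA (f g) hg
  exact ⟨PontryaginDual.map f χ, fun a ha => h1 _ ha, h2⟩

theorem IsQuasiConvex.iInter {G ι : Type*} [CommGroup G] [TopologicalSpace G] {A : ι → Set G}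
    (hA : ∀ i, IsQuasiConvex (A i)) : IsQuasiConvex (⋂ i, A i) := by
  intro g hg
  obtain ⟨i, hi⟩ := by simpa only [Set.mem_iInter, not_forall] using hg
  obtain ⟨χ, h1, h2⟩ := hA i g hi
  exact ⟨χ, fun a ha => h1 a (Set.mem_iInter.1 ha i), h2⟩

theorem IsQuasiConvex.inter {G : Type*} [CommGroup G] [TopologicalSpace G] {A B : Set G}
    (hA : IsQuasiConvex A) (hB : IsQuasiConvex B) : IsQuasiConvex (A ∩ B) := by
  rw [Set.inter_eq_iInter]
  exact .iInter (Bool.forall_bool.2 ⟨hB, hA⟩)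

theorem isQuasiConvex_setOf_re_nonneg {G : Type*} [CommGroup G] [TopologicalSpace G]
    (χ : PontryaginDual G) : IsQuasiConvex {g | 0 ≤ (χ g : ℂ).re} :=
  fun _ hg => ⟨χ, fun _ ha => ha, not_le.1 hg⟩

theorem IsLocallyQuasiConvex.of_isInducing {G H : Type*} [CommGroup G] [TopologicalSpace G]
    [CommGroup H] [TopologicalSpace H] (hH : IsLocallyQuasiConvex H) (f : G →* H)
    (hf : IsInducing f) : IsLocallyQuasiConvex G := by
  intro U hU
  rw [hf.nhds_eq_comap, map_one] at hU
  obtain ⟨W, hW, hWU⟩ := hU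
  obtain ⟨V, hV, hVW, hVq⟩ := hH W hW
  refine ⟨f ⁻¹' V, ?_, (Set.preimage_mono hVW).trans hWU, hVq.preimage ⟨f, hf.continuous⟩⟩
  exact hf.continuous.continuousAt.preimage_mem_nhds (by rwa [map_one])

theorem IsLocallyQuasiConvex.prod {G H : Type*} [CommGroup G] [TopologicalSpace G]
    [CommGroup H] [TopologicalSpace H] (hG : IsLocallyQuasiConvex G)
    (hH : IsLocallyQuasiConvex H) : IsLocallyQuasiConvex (G × H) := by
  intro U hU
  obtain ⟨W₁, hW₁, W₂, hW₂, hWU⟩ := mem_nhds_prod_iff.1 hU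
  obtain ⟨V₁, hV₁, hVW₁, hq₁⟩ := hG W₁ hW₁
  obtain ⟨V₂, hV₂, hVW₂, hq₂⟩ := hH W₂ hW₂
  exact ⟨V₁ ×ˢ V₂, prod_mem_nhds hV₁ hV₂, (Set.prod_mono hVW₁ hVW₂).trans hWU,
    (hq₁.preimage (.fst G H)).inter (hq₂.preimage (.snd G H))⟩

theorem IsLocallyQuasiConvex.pi {ι : Type*} {G : ι → Type*} [∀ i, CommGroup (G i)]
    [∀ i, TopologicalSpace (G i)] (hG : ∀ i, IsLocallyQuasiConvex (G i)) :
    IsLocallyQuasiConvex (∀ i, G i) := by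
  intro U hU
  rw [nhds_pi, Filter.mem_pi] at hU
  obtain ⟨I, hI, W, hW, hWU⟩ := hU
  choose V hV hVW hq using fun i => hG i (W i) (hW i)
  refine ⟨I.pi V, set_pi_mem_nhds hI fun i _ => hV i, (Set.pi_mono fun i _ => hVW i).trans hWU, ?_⟩
  rw [Set.pi_def, Set.biInter_eq_iInter]
  exact .iInter fun i => (hq i).preimage ⟨Pi.evalMonoidHom G i, continuous_apply _⟩

/-- If the first `m` iterated squares of `z` stay in the right half of the circle, then `z` is
close to `1`. -/
theorem Circle.sq_norm_sub_one_mul_two_pow_le (m : ℕ) (z : Circle)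
    (h : ∀ j < m, 0 ≤ ((z ^ 2 ^ j : Circle) : ℂ).re) : ‖(z : ℂ) - 1‖ ^ 2 * 2 ^ m ≤ 4 := by
  induction m generalizing z with
  | zero =>
    have h1 : ‖(z : ℂ) - 1‖ ≤ 2 := by
      refine (norm_sub_le _ _).trans ?_
      rw [Circle.norm_coe, norm_one]
      norm_num
    nlinarith [norm_nonneg ((z : ℂ) - 1)]
  | succ m ih =>
    have h1 := ih (z ^ 2) fun j hj => by
      have := h (j + 1) (by lia)
      rwa [pow_succ', pow_mul] at this
    have h2 : 0 ≤ (z : ℂ).re := by simpa using h 0 (by lia)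
    -- `|z + 1|² = 2 + 2 Re z`, so by `z² - 1 = (z - 1)(z + 1)` each squaring at least doubles `|z -
    -- 1|²`, which never exceeds 4.
    have h3 : 2 ≤ ‖(z : ℂ) + 1‖ ^ 2 := by
      have h4 : (z : ℂ).re * (z : ℂ).re + (z : ℂ).im * (z : ℂ).im = 1 := by
        rw [← Complex.normSq_apply, Circle.normSq_coe]
      rw [← Complex.normSq_eq_norm_sq, Complex.normSq_apply]
      simp only [Complex.add_re, Complex.add_im, Complex.one_re, Complex.one_im]
      nlinarith
    have h5 : ((z ^ 2 : Circle) : ℂ) - 1 = (z - 1) * (z + 1) := by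
      rw [Circle.coe_pow]
      ring
    rw [h5, norm_mul, mul_pow] at h1
    have h6 : ‖(z : ℂ) - 1‖ ^ 2 * 2 ≤ ‖(z : ℂ) - 1‖ ^ 2 * ‖(z : ℂ) + 1‖ ^ 2 := by gcongr
    calc ‖(z : ℂ) - 1‖ ^ 2 * 2 ^ (m + 1) = ‖(z : ℂ) - 1‖ ^ 2 * 2 * 2 ^ m := by ring
      _ ≤ ‖(z : ℂ) - 1‖ ^ 2 * ‖(z : ℂ) + 1‖ ^ 2 * 2 ^ m := by gcongr
      _ ≤ 4 := h1

/-- The uniformity of `m` in `z` is what lets the same `m` serve all coordinates of `T0H`. -/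
theorem Circle.exists_forall_norm_sub_one_lt {ε : ℝ} (hε : 0 < ε) :
    ∃ m : ℕ, ∀ z : Circle, (∀ j < m, 0 ≤ ((z ^ 2 ^ j : Circle) : ℂ).re) → ‖(z : ℂ) - 1‖ < ε := by
  obtain ⟨m, hm⟩ := pow_unbounded_of_one_lt (4 / ε ^ 2) one_lt_two
  refine ⟨m, fun z hz => ?_⟩
  have h1 := Circle.sq_norm_sub_one_mul_two_pow_le m z hz
  rw [div_lt_iff₀ (by positivity), mul_comm] at hm
  have h2 := lt_of_mul_lt_mul_right (h1.trans_lt hm) (by positivity)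
  exact lt_of_pow_lt_pow_left₀ 2 hε.le h2

theorem Circle.isQuasiConvex_setOf_pow (m : ℕ) :
    IsQuasiConvex {z : Circle | ∀ j < m, 0 ≤ ((z ^ 2 ^ j : Circle) : ℂ).re} := by
  have h : {z : Circle | ∀ j < m, 0 ≤ ((z ^ 2 ^ j : Circle) : ℂ).re} =
      ⋂ j : Set.Iio m, {z : Circle | 0 ≤ ((z ^ 2 ^ (j : ℕ) : Circle) : ℂ).re} := by
    ext z
    simp
  rw [h]
  exact .iInter fun j => isQuasiConvex_setOf_re_nonneg
    (⟨powMonoidHom (2 ^ (j : ℕ)), continuous_pow _⟩ : Circle →ₜ* Circle)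

theorem Circle.setOf_pow_mem_nhds_one (m : ℕ) :
    {z : Circle | ∀ j < m, 0 ≤ ((z ^ 2 ^ j : Circle) : ℂ).re} ∈ 𝓝 1 := by
  have h : ∀ j ∈ Set.Iio m, ∀ᶠ z : Circle in 𝓝 1, 0 < ((z ^ 2 ^ j : Circle) : ℂ).re := by
    intro j _
    have hc : Continuous fun z : Circle => ((z ^ 2 ^ j : Circle) : ℂ).re := by fun_prop
    exact (isOpen_Ioi.preimage hc).mem_nhds (by simp)
  exact ((eventually_all_finite (Set.finite_Iio m)).2 h).mono fun z hz j hj => (hz j hj).le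

theorem Circle.dist_eq_norm_sub (z w : Circle) : dist z w = ‖(z : ℂ) - w‖ :=
  (Subtype.dist_eq _ _).trans (dist_eq_norm _ _)

theorem Circle.dist_inv_inv (z w : Circle) : dist z⁻¹ w⁻¹ = dist z w := by
  rw [Circle.dist_eq_norm_sub, Circle.dist_eq_norm_sub, Circle.coe_inv_eq_conj,
    Circle.coe_inv_eq_conj, ← map_sub, RCLike.norm_conj]

theorem Circle.dist_mul_mul_le (z w z' w' : Circle) :
    dist (z * w) (z' * w') ≤ dist z z' + dist w w' := by
  simp only [Circle.dist_eq_norm_sub, Circle.coe_mul]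
  have h : (z * w - z' * w' : ℂ) = (z - z') * w + z' * (w - w') := by ring
  rw [h]
  refine (norm_add_le _ _).trans_eq ?_
  rw [norm_mul, norm_mul, Circle.norm_coe, Circle.norm_coe, mul_one, one_mul]

theorem Circle.isLocallyQuasiConvex : IsLocallyQuasiConvex Circle := by
  intro U hU
  obtain ⟨ε, hε, hεU⟩ := Metric.mem_nhds_iff.1 hU
  obtain ⟨m, hm⟩ := Circle.exists_forall_norm_sub_one_lt hε
  exact ⟨_, Circle.setOf_pow_mem_nhds_one m, fun z hz => hεU ((Circle.dist_eq_norm_sub z 1).trans_lt (by simpa using hm z hz)),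
    Circle.isQuasiConvex_setOf_pow m⟩

theorem isLocallyQuasiConvex_of_compact {X : Type*} [CommGroup X] [TopologicalSpace X]
    [IsTopologicalGroup X] [CompactSpace X] [TopologicalSpace.MetrizableSpace X] :
    IsLocallyQuasiConvex X := by
  let f : X →* (PontryaginDual X → Circle) :=
    { toFun x χ := χ x
      map_one' := funext fun χ => map_one χ
      map_mul' x y := funext fun χ => map_mul χ x y }
  have hinj : Function.Injective f := (injective_iff_map_eq_one f).2 fun a ha => by
    by_contra hne
    obtain ⟨χ, hχ⟩ := exists_pontryaginDual_apply_ne_one hne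
    exact hχ (congrFun ha χ)
  have hcont : Continuous f := continuous_pi fun χ => map_continuous χ
  exact (IsLocallyQuasiConvex.pi fun _ => Circle.isLocallyQuasiConvex).of_isInducing f
    (hcont.isClosedEmbedding hinj).isInducing

end QuasiConvex

/-! ### `T0H` as a locally quasi-convex Polish group -/

namespace T0H

theorem coord_one (n : ℕ) : (1 : T0H).coord n = 1 := rfl

theorem coord_mul (z w : T0H) (n : ℕ) : (z * w).coord n = z.coord n * w.coord n := rfl

theorem coord_inv (z : T0H) (n : ℕ) : z⁻¹.coord n = (z.coord n)⁻¹ := rfl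

theorem tendsto_coord (z : T0H) : Tendsto z.coord atTop (𝓝 1) := z.2

theorem dist_coord_le (z w : T0H) (n : ℕ) : dist (z.coord n) (w.coord n) ≤ dist z w :=
  (Circle.dist_eq_norm_sub _ _).trans_le (le_ciSup (bddAbove_dist z w) n)

theorem dist_le_of_forall {z w : T0H} {r : ℝ} (h : ∀ n, dist (z.coord n) (w.coord n) ≤ r) :
    dist z w ≤ r :=
  ciSup_le fun n => (Circle.dist_eq_norm_sub _ _).symm.trans_le (h n)

theorem continuous_coord (n : ℕ) : Continuous fun z : T0H => z.coord n :=
  (LipschitzWith.of_dist_le_mul (K := 1) fun z w => by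
    simpa using dist_coord_le z w n).continuous

instance : IsTopologicalGroup T0H where
  continuous_mul := by
    have h : LipschitzWith 2 fun p : T0H × T0H => p.1 * p.2 :=
      LipschitzWith.of_dist_le_mul fun p q => dist_le_of_forall fun n => by
        have h1 := Circle.dist_mul_mul_le (p.1.coord n) (p.2.coord n) (q.1.coord n) (q.2.coord n)
        have h2 := (dist_coord_le p.1 q.1 n).trans (le_max_left _ (dist p.2 q.2))
        have h3 := (dist_coord_le p.2 q.2 n).trans (le_max_right (dist p.1 q.1) _)
        rw [coord_mul, coord_mul, Prod.dist_eq]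
        change _ ≤ (2 : ℝ) * _
        linarith
    exact h.continuous
  continuous_inv := (LipschitzWith.of_dist_le_mul (K := 1) fun z w => by
    simpa using dist_le_of_forall fun n => by
      simpa [coord_inv, Circle.dist_inv_inv] using dist_coord_le z w n).continuous

/-- The `n`-th coordinate as a continuous character. -/
def coordHom (n : ℕ) : T0H →ₜ* Circle where
  toFun z := z.coord n
  map_one' := coord_one n
  map_mul' z w := coord_mul z w n
  continuous_toFun := continuous_coord n

theorem isLocallyQuasiConvex : IsLocallyQuasiConvex T0H := by
  intro U hU
  obtain ⟨ε, hε, hεU⟩ := Metric.mem_nhds_iff.1 hU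
  -- Half of `ε`, because strict bounds on coordinates give only a weak bound on their supremum.
  obtain ⟨m, hm⟩ := Circle.exists_forall_norm_sub_one_lt (half_pos hε)
  set V := {z : Circle | ∀ j < m, 0 ≤ ((z ^ 2 ^ j : Circle) : ℂ).re} with hV
  refine ⟨⋂ n, coordHom n ⁻¹' V, ?_, fun z hz => hεU (?_ : dist z 1 < ε), .iInter fun n =>
    (Circle.isQuasiConvex_setOf_pow m).preimage _⟩
  · obtain ⟨δ, hδ, hδV⟩ := Metric.mem_nhds_iff.1 (Circle.setOf_pow_mem_nhds_one m)
    refine mem_of_superset (Metric.ball_mem_nhds 1 hδ) fun z hz => Set.mem_iInter.2 fun n => ?_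
    exact hδV ((dist_coord_le z 1 n).trans_lt hz)
  · refine (dist_le_of_forall fun n => ?_).trans_lt (half_lt_self hε)
    rw [Circle.dist_eq_norm_sub, coord_one, Circle.coe_one]
    exact (hm (z.coord n) (Set.mem_iInter.1 hz n)).le

/-- The isometric embedding into the space of bounded sequences. -/
noncomputable def toBCF (z : T0H) : BoundedContinuousFunction ℕ Circle :=
  BoundedContinuousFunction.mkOfDiscrete z.coord 2 fun m n => by
    rw [Circle.dist_eq_norm_sub]
    refine (norm_sub_le _ _).trans ?_
    rw [Circle.norm_coe, Circle.norm_coe]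
    norm_num

theorem isometry_toBCF : Isometry toBCF := Isometry.of_dist_eq fun z w =>
  le_antisymm ((BoundedContinuousFunction.dist_le dist_nonneg).2 fun n => dist_coord_le z w n)
    (dist_le_of_forall fun n => BoundedContinuousFunction.dist_coe_le_dist (f := toBCF z) (g := toBCF w) n)

theorem range_toBCF :
    Set.range toBCF = {f : BoundedContinuousFunction ℕ Circle | Tendsto f atTop (𝓝 1)} := by
  ext f
  constructor
  · rintro ⟨z, rfl⟩
    exact z.tendsto_coord
  · exact fun hf => ⟨⟨f, hf⟩, BoundedContinuousFunction.ext fun _ => rfl⟩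

theorem isClosed_range_toBCF : IsClosed (Set.range toBCF) := by
  rw [range_toBCF]
  refine isClosed_of_closure_subset fun f hf => Metric.tendsto_atTop.2 fun ε hε => ?_
  obtain ⟨g, hg, hfg⟩ := Metric.mem_closure_iff.1 hf (ε / 2) (half_pos hε)
  obtain ⟨N, hN⟩ := Metric.tendsto_atTop.1 hg (ε / 2) (half_pos hε)
  refine ⟨N, fun n hn => ?_⟩
  have h1 := (BoundedContinuousFunction.dist_coe_le_dist (f := f) (g := g) n).trans_lt hfg
  linarith [dist_triangle (f n) (g n) 1, hN n hn]

instance : CompleteSpace T0H :=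
  ((completeSpace_iff_isComplete_range isometry_toBCF.isUniformInducing).2
    isClosed_range_toBCF.isComplete)

/-- The eventually trivial sequence with values in a fixed dense sequence of the circle that is
encoded by a finitely supported function. -/
noncomputable def ofFinsupp (f : ℕ →₀ ℕ) : T0H :=
  -- The value 0 is reserved for the coordinate 1, hence the index shift.
  ⟨fun n => if f n = 0 then 1 else TopologicalSpace.denseSeq Circle (f n - 1), by
    refine tendsto_const_nhds.congr' ?_
    have h : ∀ᶠ n in atTop, n ∉ f.support := by
      rw [← Nat.cofinite_eq_atTop]
      exact f.support.finite_toSet.compl_mem_cofinite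
    exact h.mono fun n hn => (if_pos (Finsupp.notMem_support_iff.1 hn)).symm⟩

theorem coord_ofFinsupp (f : ℕ →₀ ℕ) (n : ℕ) : (ofFinsupp f).coord n =
    if f n = 0 then 1 else TopologicalSpace.denseSeq Circle (f n - 1) := rfl

theorem denseRange_ofFinsupp : DenseRange ofFinsupp := by
  refine Metric.denseRange_iff.2 fun z ε hε => ?_
  obtain ⟨N, hN⟩ := Metric.tendsto_atTop.1 z.tendsto_coord (ε / 2) (half_pos hε)
  choose k hk using fun n => Metric.denseRange_iff.1 (TopologicalSpace.denseRange_denseSeq Circle)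
    (z.coord n) (ε / 2) (half_pos hε)
  refine ⟨Finsupp.onFinset (Finset.range N) (fun n => if n < N then k n + 1 else 0)
    fun n hn => by simpa using hn, (dist_le_of_forall fun n => ?_).trans_lt (half_lt_self hε)⟩
  rw [coord_ofFinsupp, Finsupp.onFinset_apply]
  by_cases h : n < N
  · simpa [h] using (hk n).le
  · simpa [h] using (hN n (not_lt.1 h)).le

instance : TopologicalSpace.SeparableSpace T0H :=
  ⟨_, Set.countable_range ofFinsupp, denseRange_ofFinsupp⟩

instance : PolishSpace T0H := by
  have : SecondCountableTopology T0H := UniformSpace.secondCountable_of_separable T0H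
  infer_instance

end T0H

/-! ### The graph and the transported topology -/

section Graph

variable {X : Type*} [CommGroup X] [TopologicalSpace X] (u : ℕ → PontryaginDual X)

theorem isClosed_graphSubgroup : IsClosed (graphSubgroup u : Set (X × T0H)) := by
  have h : (graphSubgroup u : Set (X × T0H)) = ⋂ n, {p | p.2.coord n = u n p.1} := by
    ext p
    simp only [Set.mem_iInter, Set.mem_ofPred_eq]
    refine ⟨fun hp => hp.2, fun hp => ⟨?_, hp⟩⟩
    exact p.2.tendsto_coord.congr hp
  rw [h]
  exact isClosed_iInter fun n => isClosed_eq ((T0H.continuous_coord n).comp continuous_snd)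
    ((map_continuous (u n)).comp continuous_fst)

/-- The isomorphism of `s_u(X)` onto `G_u`. -/
noncomputable def graphEquiv : characterizedSubgroup u ≃* graphSubgroup u where
  toFun g := ⟨(g, ⟨fun n => u n (g : X), g.2⟩), g.2, fun _ => rfl⟩
  invFun p := ⟨p.1.1, p.2.1⟩
  left_inv _ := rfl
  right_inv p := Subtype.ext (Prod.ext rfl (T0H.ext_coord fun n => (p.2.2 n).symm))
  map_mul' g h := Subtype.ext (Prod.ext rfl (T0H.ext_coord fun n => map_mul (u n) (g : X) h))

end Graph

theorem corollary1 {X : Type*} [CommGroup X] [TopologicalSpace X] [IsTopologicalGroup X]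
    [CompactSpace X] [TopologicalSpace.MetrizableSpace X] (u : ℕ → PontryaginDual X) :
    IsClosed (graphSubgroup u : Set (X × T0H)) ∧
    ∃ τ : TopologicalSpace (characterizedSubgroup u),
      @IsTopologicalGroup (characterizedSubgroup u) τ _ ∧
      @PolishSpace (characterizedSubgroup u) τ ∧
      @IsLocallyQuasiConvex (characterizedSubgroup u) _ τ ∧
      @Continuous (characterizedSubgroup u) X τ _ (fun g => (g : X)) ∧
      ∃ e : characterizedSubgroup u ≃* graphSubgroup u,
        @IsHomeomorph (characterizedSubgroup u) (graphSubgroup u) τ _ e ∧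
        ∀ g : characterizedSubgroup u,
          (e g : X × T0H).1 = (g : X) ∧
          ∀ n, (e g : X × T0H).2.coord n = u n (g : X) := by
  have hclosed := isClosed_graphSubgroup u
  have hpolish : PolishSpace (graphSubgroup u) := by
    let _ := TopologicalSpace.metrizableSpaceMetric X
    have : SecondCountableTopology X := inferInstance
    exact hclosed.polishSpace
  have hlqc : IsLocallyQuasiConvex (graphSubgroup u) :=
    (isLocallyQuasiConvex_of_compact.prod T0H.isLocallyQuasiConvex).of_isInducing
      (graphSubgroup u).subtype IsInducing.subtypeVal
  -- `τ` has to be passed explicitly throughout, since `s_u(X)` already carries the subspace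
  -- topology of `X` as an instance.
  let τ : TopologicalSpace (characterizedSubgroup u) := .induced (graphEquiv u) inferInstance
  have hind : @IsInducing _ _ τ _ (graphEquiv u) := @IsInducing.mk _ _ τ _ _ rfl
  have hhomeo : @IsHomeomorph _ _ τ _ (graphEquiv u) :=
    (@Equiv.toHomeomorphOfIsInducing _ _ τ _ (graphEquiv u).toEquiv hind).isHomeomorph
  refine ⟨hclosed, τ, topologicalGroup_induced (graphEquiv u), ?_, ?_, ?_, graphEquiv u, hhomeo,
    fun g => ⟨rfl, fun _ => rfl⟩⟩
  · exact @IsClosedEmbedding.polishSpace _ _ τ _ hpolish _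
      (@IsHomeomorph.isClosedEmbedding _ _ τ _ _ hhomeo)
  · exact @IsLocallyQuasiConvex.of_isInducing _ _ _ τ _ _ hlqc (graphEquiv u).toMonoidHom hind
  · have hfst : Continuous fun p : graphSubgroup u => (p : X × T0H).1 :=
      continuous_fst.comp continuous_subtype_val
    exact @Continuous.comp _ _ _ τ _ _ (graphEquiv u) _ hfst
      (@IsHomeomorph.continuous _ _ τ _ _ hhomeo)
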